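/- Let $m, N \ge 1$. The instance $I_N$ consists of $m$ parallel identical machines and $Nm$ jobs whose processing times $P_j$ are independent with $P_j \sim \operatorname{Bernoulli}(1/N)$, i.e. $\Pr(P_j = 1) = 1/N$ and $\Pr(P_j = 0) = 1 - 1/N$. A $1$-active policy works as follows. At every integer time $t = 0, 1, 2, \dots$ it (re)assigns all remaining (not yet started) jobs to the machines, each remaining job to exactly one machine, and fixes an order of the jobs on each machine. The decision is non-anticipatory: it may depend on $t$ and on the start times and processing times of the jobs started before time $t$, but not on the processing times of the remaining jobs. From time $t$ on, every machine processes its jobs in the given order without idling, so at time $t$ it starts its jobs up to and including the first job of processing time $1$, which keeps it busy until time $t+1$; the jobs behind it are remaining jobs at time $t+1$. The cost of a policy is its expected makespan, i.e. the expected value of the largest completion time of a job. Call a $1$-active policy balanced if, at every integer time that it can reach, with $r$ remaining jobs, it assigns $\lfloor r/m \rfloor$ or $\lceil r/m \rceil$ of them to each machine. Then balanced $1$-active policies exist, and every balanced $1$-active policy minimizes the expected makespan on $I_N$ among all $1$-active policies. -/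

import Mathlib

open MeasureTheory ProbabilityTheory

/-- What is known at an integer time about jobs whose processing times are `0` or `1`:
for a job that has been started already, its start time and its processing time
(all such jobs are completed by then), and `none` for a remaining job. -/
abbrev History (n : ℕ) : Type := Fin n → Option (ℕ × Fin 2)

/-- The number of remaining (not yet started) jobs. -/
def History.numRemaining {n : ℕ} (h : History n) : ℕ :=
  (Finset.univ.filter fun j => h j = none).card

/-- A (deterministic, non-anticipatory) `1`-active policy for `m` machines and `n` jobs with
processing times in `{0, 1}`: at every integer time `t` it (re)assigns every remaining job to exactly
one machine. `assign t h i` is the ordered list of the jobs that machine `i` receives at time `t`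
when the history is `h`. -/
structure ActivePolicy (m n : ℕ) where
  assign : ℕ → History n → Fin m → List (Fin n)
  /-- Every remaining job occurs exactly once in the lists; jobs already started do not occur. -/
  valid : ∀ (t : ℕ) (h : History n) (j : Fin n),
    ∑ i, (assign t h i).count j = if h j = none then 1 else 0

/-- The jobs of a list that a machine starts in the unit of time following the assignment of the
list, when it processes the list in order without idling: the jobs up to and including the first
job of processing time `1`. All of them start at the time of the assignment; the machine is then
busy until the next integer time (or has emptied its list). -/
def startedJobs {n : ℕ} (p : Fin n → Fin 2) : List (Fin n) → List (Fin n)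
  | [] => []
  | j :: l => if p j = 1 then [j] else j :: startedJobs p l

namespace ActivePolicy

variable {m n : ℕ}

/-- The history at time `t` under the policy `π`, if the processing times are `p`. -/
def history (π : ActivePolicy m n) (p : Fin n → Fin 2) : ℕ → History n
  | 0 => fun _ => none
  | t + 1 => fun j =>
      if history π p t j = none ∧ ∃ i, j ∈ startedJobs p (π.assign t (history π p t) i)
      then some (t, p j) else history π p t j

theorem exists_started (π : ActivePolicy m n) (p : Fin n → Fin 2) (t : ℕ) (j : Fin n)
    (hj : π.history p t j = none) :
    ∃ j', π.history p t j' = none ∧ π.history p (t + 1) j' ≠ none := by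
  have hv := π.valid t (π.history p t)
  have h1 := hv j
  rw [if_pos hj] at h1
  obtain ⟨i, -, hi⟩ := Finset.exists_ne_zero_of_sum_ne_zero (by rw [h1]; exact one_ne_zero)
  cases hl : π.assign t (π.history p t) i with
  | nil => simp [hl] at hi
  | cons a l =>
    have ha : π.history p t a = none := by
      by_contra hne
      have h2 := hv a
      rw [if_neg hne, Finset.sum_eq_zero_iff] at h2
      have h3 := h2 i (Finset.mem_univ i)
      simp [hl] at h3
    refine ⟨a, ha, ?_⟩
    have hs : ∃ i, a ∈ startedJobs p (π.assign t (π.history p t) i) := by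
      refine ⟨i, ?_⟩
      rw [hl, startedJobs]
      split_ifs <;> simp
    simp [history, ha, hs]

theorem history_mono (π : ActivePolicy m n) (p : Fin n → Fin 2) (t : ℕ) (j : Fin n)
    (hj : π.history p (t + 1) j = none) : π.history p t j = none := by
  by_contra hne
  simp [history, hne] at hj

theorem numRemaining_le (π : ActivePolicy m n) (p : Fin n → Fin 2) (t : ℕ) :
    (π.history p t).numRemaining ≤ n - t := by
  induction t with
  | zero =>
    refine (Finset.card_le_univ _).trans ?_
    simp
  | succ t ih =>
    by_cases h : ∃ j, π.history p t j = none
    · obtain ⟨j, hj⟩ := h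
      obtain ⟨a, ha, ha'⟩ := π.exists_started p t j hj
      have : (π.history p (t + 1)).numRemaining < (π.history p t).numRemaining := by
        refine Finset.card_lt_card
          (Finset.ssubset_iff_of_subset ?_ |>.2 ⟨a, by simpa using ha, by simpa using ha'⟩)
        intro b hb
        simpa using π.history_mono p t b (by simpa using hb)
      omega
    · have : (π.history p (t + 1)).numRemaining = 0 := by
        rw [History.numRemaining, Finset.card_eq_zero, Finset.filter_eq_empty_iff]
        intro b _ hb
        exact h ⟨b, π.history_mono p t b hb⟩
      omega

/-- Every job is eventually started. -/
theorem exists_start (π : ActivePolicy m n) (p : Fin n → Fin 2) (j : Fin n) :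
    ∃ t, π.history p (t + 1) j ≠ none := by
  refine ⟨n, fun h => ?_⟩
  have h0 : (π.history p (n + 1)).numRemaining = 0 := by
    have := π.numRemaining_le p (n + 1)
    omega
  rw [History.numRemaining, Finset.card_eq_zero, Finset.filter_eq_empty_iff] at h0
  exact h0 (Finset.mem_univ j) h

/-- The start time of job `j` under the policy `π`, if the processing times are `p`. -/
def startTime (π : ActivePolicy m n) (p : Fin n → Fin 2) (j : Fin n) : ℕ :=
  Nat.find (π.exists_start p j)

/-- The makespan: the largest completion time (start time plus processing time) of a job. -/
def makespan (π : ActivePolicy m n) (p : Fin n → Fin 2) : ℕ :=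
  Finset.univ.sup fun j => π.startTime p j + (p j : ℕ)

/-- The policy is balanced: whenever it reassigns the `r` remaining jobs, every machine gets
`⌊r / m⌋` or `⌈r / m⌉` of them (`⌈/⌉` is division rounded up). Only assignments that the policy can
actually come to make are restricted. -/
def IsBalanced (π : ActivePolicy m n) : Prop :=
  ∀ (p : Fin n → Fin 2) (t : ℕ) (i : Fin m),
    (π.assign t (π.history p t) i).length = (π.history p t).numRemaining / m ∨
    (π.assign t (π.history p t) i).length = (π.history p t).numRemaining ⌈/⌉ m

end ActivePolicy

/-- `P` is a realization on `(Ω, μ)` of the random processing times of the instance `I_N` on `m`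
machines: `N * m` independent jobs, each with a Bernoulli(`1 / N`) processing time. -/
structure IsInstance {Ω : Type*} [MeasurableSpace Ω] (μ : Measure Ω) (m N : ℕ)
    (P : Fin (N * m) → Ω → Fin 2) : Prop where
  indep : iIndepFun P μ
  law : ∀ j, HasLaw (P j)
    (bernoulliMeasure 1 0 ⟨(N : ℝ)⁻¹, inv_nonneg.2 N.cast_nonneg, Nat.cast_inv_le_one N⟩) μ

/-- The expected makespan of the policy `π` for the random processing times `P`. -/
noncomputable def expectedMakespan {Ω : Type*} [MeasurableSpace Ω] (μ : Measure Ω) {m n : ℕ}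
    (P : Fin n → Ω → Fin 2) (π : ActivePolicy m n) : ℝ :=
  ∫ ω, (π.makespan (fun j => P j ω) : ℝ) ∂μ

/-! The makespan is the number of integer times at which some remaining job has length 1. Given the
history, the remaining jobs are still independent Bernoulli(`q`) variables (`bernoulliExp_resample`,
`history_congr`). So, with `r` jobs remaining, the next unit of time costs `1 - (1 - q) ^ r` in
expectation whatever the assignment, and a decision matters only through the law of the number of
jobs it leaves over.

A list of length `k` leaves a number of jobs with generating function `leftoverGen q k`, and
different machines are independent, so the total has the product as its generating function. An
exchange argument (`leftoverGen_exchange`) shows that a balanced split makes this total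
stochastically smallest (`stochLE_prod_leftoverGen_of_balanced`). Since `balancedValue` is
nondecreasing in the number of remaining jobs, balanced splits are optimal in each step of the
dynamic program.

Policies are compared through `hybridCost`, which charges the policy's own cost before time `u` and
`balancedValue` afterwards. It runs from `balancedValue q m n n` at `u = 0` to the expected makespan
at `u = n`. It never decreases in `u`, and it is constant for a balanced policy. -/

/-! ### Expectations over independent Bernoulli coordinates as finite sums. -/

/-- The probability of `x` under the Bernoulli(`q`) law on `{0, 1}`. -/
noncomputable def bernoulliWeight (q : ℝ) (x : Fin 2) : ℝ := if x = 1 then q else 1 - q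

/-- The expectation of `F p` for independent Bernoulli(`q`) coordinates `p j`. -/
noncomputable def bernoulliExp {ι M : Type*} [Fintype ι] [DecidableEq ι] [AddCommGroup M]
    [Module ℝ M] (q : ℝ) (F : (ι → Fin 2) → M) : M :=
  ∑ p, (∏ j, bernoulliWeight q (p j)) • F p

section bernoulliExp

variable {ι M M' : Type*} [Fintype ι] [DecidableEq ι] [AddCommGroup M] [Module ℝ M]
  [AddCommGroup M'] [Module ℝ M'] {q : ℝ}

theorem bernoulliWeight_nonneg (h0 : 0 ≤ q) (h1 : q ≤ 1) (x : Fin 2) :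
    0 ≤ bernoulliWeight q x := by
  unfold bernoulliWeight; split_ifs <;> linarith

theorem sum_prod_bernoulliWeight (q : ℝ) :
    ∑ p : ι → Fin 2, ∏ j, bernoulliWeight q (p j) = 1 := by
  rw [← Fintype.prod_sum (fun (_ : ι) x => bernoulliWeight q x)]
  simp [Fin.sum_univ_two, bernoulliWeight]

theorem bernoulliExp_const (x : M) : bernoulliExp q (fun _ : ι → Fin 2 => x) = x := by
  rw [bernoulliExp, ← Finset.sum_smul, sum_prod_bernoulliWeight, one_smul]

theorem bernoulliExp_add (F G : (ι → Fin 2) → M) :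
    bernoulliExp q (fun p => F p + G p) = bernoulliExp q F + bernoulliExp q G := by
  simp [bernoulliExp, Finset.sum_add_distrib]

/-- Module-valued expectations are needed for this: `genExp f` is pulled out of an expectation of
polynomials. -/
theorem map_bernoulliExp (φ : M →ₗ[ℝ] M') (F : (ι → Fin 2) → M) :
    φ (bernoulliExp q F) = bernoulliExp q fun p => φ (F p) := by
  simp [bernoulliExp]

theorem bernoulliExp_mono (h0 : 0 ≤ q) (h1 : q ≤ 1) {F G : (ι → Fin 2) → ℝ}
    (h : ∀ p, F p ≤ G p) : bernoulliExp q F ≤ bernoulliExp q G :=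
  Finset.sum_le_sum fun p _ => mul_le_mul_of_nonneg_left (h p)
    (Finset.prod_nonneg fun _ _ => bernoulliWeight_nonneg h0 h1 _)

/-- If the event `H p = h` and the set `S h` are such that `H p = h` only depends on the
coordinates in `S h`, and `G h p` only on the other ones, then the latter may be resampled. -/
theorem bernoulliExp_resample {β : Type*} (H : (ι → Fin 2) → β) (S : β → Finset ι)
    (hH : ∀ p p', (∀ j ∈ S (H p), p' j = p j) → H p' = H p) (G : β → (ι → Fin 2) → M)
    (hG : ∀ p p' p'', (∀ j ∉ S (H p), p' j = p'' j) → G (H p) p' = G (H p) p'') :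
    bernoulliExp q (fun p => G (H p) p) =
      bernoulliExp q fun p => bernoulliExp q fun p' => G (H p) p' := by
  -- Take two independent copies and swap their coordinates outside `S (H x.1)`. This leaves `H x.1`
  -- unchanged, so `T` is an involution, and it preserves the product weight.
  let T : (ι → Fin 2) × (ι → Fin 2) → (ι → Fin 2) × (ι → Fin 2) := fun x =>
    ((S (H x.1)).piecewise x.1 x.2, (S (H x.1)).piecewise x.2 x.1)
  have hT1 : ∀ x, H (T x).1 = H x.1 := fun x => hH _ _ fun _ hj => by simp [T, hj]
  have hT : Function.Involutive T := by
    intro x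
    have h := hT1 x
    refine Prod.ext ?_ ?_ <;> ext j <;> by_cases hj : j ∈ S (H x.1) <;>
      simp [T, Finset.piecewise, hj] at h ⊢ <;> simp [h, hj]
  have hw : ∀ x, (∏ j, bernoulliWeight q ((T x).1 j)) * ∏ j, bernoulliWeight q ((T x).2 j) =
      (∏ j, bernoulliWeight q (x.1 j)) * ∏ j, bernoulliWeight q (x.2 j) := by
    intro x
    rw [← Finset.prod_mul_distrib, ← Finset.prod_mul_distrib]
    refine Finset.prod_congr rfl fun j _ => ?_
    by_cases hj : j ∈ S (H x.1) <;> simp [T, hj, mul_comm]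
  have key : ∀ K : (ι → Fin 2) → (ι → Fin 2) → M,
      bernoulliExp q (fun p => bernoulliExp q fun p' => K p p') =
      ∑ x : (ι → Fin 2) × (ι → Fin 2), ((∏ j, bernoulliWeight q (x.1 j)) *
        ∏ j, bernoulliWeight q (x.2 j)) • K x.1 x.2 := by
    intro K
    simp only [bernoulliExp, Finset.smul_sum, smul_smul, Fintype.sum_prod_type]
  have h1 : bernoulliExp q (fun p => G (H p) p) =
      bernoulliExp q fun p => bernoulliExp q fun _ : ι → Fin 2 => G (H p) p := by
    simp only [bernoulliExp_const]
  rw [h1, key, key, ← Equiv.sum_comp hT.toPerm]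
  refine Finset.sum_congr rfl fun x _ => ?_
  rw [Function.Involutive.coe_toPerm, hw, hT1]
  congr 1
  exact hG _ _ _ fun j hj => by simp [T, hj]

/-- The expectation by conditioning on one coordinate. -/
theorem bernoulliExp_ite (j : ι) (A B : (ι → Fin 2) → M)
    (hA : ∀ p p', (∀ i ≠ j, p i = p' i) → A p = A p')
    (hB : ∀ p p', (∀ i ≠ j, p i = p' i) → B p = B p') :
    bernoulliExp q (fun p => if p j = 1 then A p else B p) =
      q • bernoulliExp q A + (1 - q) • bernoulliExp q B := by
  rw [bernoulliExp_resample (fun p => p j) (fun _ => {j})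
    (fun p p' h => h j (by simp)) (fun x p => if x = 1 then A p else B p)]
  · have h1 : ∀ p : ι → Fin 2, (bernoulliExp q fun p' => if p j = 1 then A p' else B p') =
        if p j = 1 then bernoulliExp q A else bernoulliExp q B := by
      intro p; split_ifs <;> rfl
    simp only [h1]
    have h2 : bernoulliExp q (fun p : ι → Fin 2 => if p j = 1 then (1 : ℝ) else 0) = q := by
      have : ∀ p : ι → Fin 2, (∏ i, bernoulliWeight q (p i)) • (if p j = 1 then (1 : ℝ) else 0) =
          ∏ i, bernoulliWeight q (p i) * (if i = j then if p i = 1 then 1 else 0 else 1) := by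
        intro p
        rw [Finset.prod_mul_distrib, Finset.prod_ite_eq' Finset.univ j]
        simp
      rw [bernoulliExp, Finset.sum_congr rfl fun p _ => this p,
        ← Fintype.prod_sum fun (i : ι) x =>
          bernoulliWeight q x * (if i = j then if x = 1 then 1 else 0 else 1),
        Finset.prod_eq_single j]
      · simp [bernoulliWeight]
      · intro i _ hi
        simp [Fin.sum_univ_two, bernoulliWeight, hi]
      · simp
    generalize bernoulliExp q A = a
    generalize bernoulliExp q B = b
    -- An affine function of the indicator of `p j = 1` reduces the `M`-valued claim to the real
    -- expectation `h2`.
    have h3 : (fun p : ι → Fin 2 => if p j = 1 then a else b) =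
        fun p => b + (LinearMap.toSpanSingleton ℝ M (a - b)) (if p j = 1 then 1 else 0) := by
      ext p; split_ifs <;> simp
    rw [h3, bernoulliExp_add, bernoulliExp_const, ← map_bernoulliExp, h2,
      LinearMap.toSpanSingleton_apply]
    module
  · intro p p' p'' h
    simp only [Finset.mem_singleton] at h
    simp only [hA p' p'' h, hB p' p'' h]

/-- The probability that no coordinate in `s` is `1`. -/
theorem bernoulliExp_exists (s : Finset ι) :
    bernoulliExp q (fun p => if ∃ j ∈ s, p j = 1 then (1 : ℝ) else 0) =
      1 - (1 - q) ^ s.card := by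
  induction s using Finset.induction_on with
  | empty => simp [bernoulliExp_const]
  | insert a s ha ih =>
    have h : (fun p : ι → Fin 2 => if ∃ j ∈ insert a s, p j = 1 then (1 : ℝ) else 0) =
        fun p => if p a = 1 then (fun _ => (1 : ℝ)) p
          else (fun p => if ∃ j ∈ s, p j = 1 then (1 : ℝ) else 0) p := by
      ext p; by_cases h : p a = 1 <;> simp [h]
    rw [h, bernoulliExp_ite, ih, bernoulliExp_const, Finset.card_insert_of_notMem ha]
    · simp only [smul_eq_mul]; ring
    · simp
    · intro p p' h
      have : (∃ j ∈ s, p j = 1) ↔ ∃ j ∈ s, p' j = 1 :=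
        exists_congr fun j => and_congr_right fun hj => by
          rw [h j (by rintro rfl; exact ha hj)]
      simp only [this]

end bernoulliExp

/-- The expectation with respect to independent Bernoulli processing times as a finite sum. -/
theorem IsInstance.integral_eq {Ω : Type*} [MeasurableSpace Ω] {μ : Measure Ω}
    [IsProbabilityMeasure μ] {m N : ℕ} {P : Fin (N * m) → Ω → Fin 2} (hP : IsInstance μ m N P)
    (F : (Fin (N * m) → Fin 2) → ℝ) :
    ∫ ω, F (fun j => P j ω) ∂μ = bernoulliExp (N : ℝ)⁻¹ F := by
  have hm : ∀ j, AEMeasurable (P j) μ := fun j => (hP.law j).aemeasurable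
  have h1 := hP.indep.map_fun_eq_pi_map hm
  simp only [(hP.law _).map_eq] at h1
  have h2 : ∫ ω, F (fun j => P j ω) ∂μ = ∫ p, F p ∂(μ.map fun ω j => P j ω) :=
    (integral_map (aemeasurable_pi_lambda _ hm)
      (Measurable.of_discrete.aestronglyMeasurable)).symm
  rw [h2, h1, integral_fintype Integrable.of_finite]
  refine Finset.sum_congr rfl fun p _ => ?_
  congr 1
  rw [measureReal_def, Measure.pi_singleton, ENNReal.toReal_prod]
  refine Finset.prod_congr rfl fun j _ => ?_
  rw [← measureReal_def, bernoulliMeasure_real_apply _ (measurableSet_singleton _),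
    bernoulliWeight]
  generalize p j = x
  fin_cases x <;> simp

/-! ### Generating functions and the stochastic order. -/

section Leftover

open Polynomial

/-- The linear functional on polynomials with `X ^ s ↦ f s`. If `P` is the generating function of
a random variable `Y`, it maps `P` to the expectation of `f Y`. -/
noncomputable def genExp (f : ℕ → ℝ) : ℝ[X] →ₗ[ℝ] ℝ :=
  (Polynomial.basisMonomials ℝ).constr ℝ f

theorem genExp_X_pow (f : ℕ → ℝ) (s : ℕ) : genExp f (X ^ s) = f s := by
  have := (Polynomial.basisMonomials ℝ).constr_basis ℝ f s
  simpa only [genExp, Polynomial.coe_basisMonomials, Polynomial.monomial_one_right_eq_X_pow]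
    using this

theorem genExp_X_pow_mul (f : ℕ → ℝ) (s : ℕ) (P : ℝ[X]) :
    genExp f (X ^ s * P) = genExp (fun k => f (s + k)) P := by
  have : genExp f ∘ₗ LinearMap.mulLeft ℝ (X ^ s) = genExp fun k => f (s + k) := by
    refine (Polynomial.basisMonomials ℝ).ext fun k => ?_
    simp [Polynomial.monomial_one_right_eq_X_pow, ← pow_add, genExp_X_pow]
  exact LinearMap.congr_fun this P

/-- The usual stochastic order, in terms of generating functions. -/
def StochLE (P Q : ℝ[X]) : Prop := ∀ f : ℕ → ℝ, Monotone f → genExp f P ≤ genExp f Q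

/-- Multiplication by `R` is monotone in the stochastic order. -/
def StochMul (R : ℝ[X]) : Prop := ∀ P Q, StochLE P Q → StochLE (R * P) (R * Q)

theorem StochLE.refl (P : ℝ[X]) : StochLE P P := fun _ _ => le_rfl

theorem StochLE.trans {P Q R : ℝ[X]} (h : StochLE P Q) (h' : StochLE Q R) : StochLE P R :=
  fun f hf => (h f hf).trans (h' f hf)

theorem StochLE.add {P Q P' Q' : ℝ[X]} (h : StochLE P Q) (h' : StochLE P' Q') :
    StochLE (P + P') (Q + Q') := fun f hf => by
  simpa only [map_add] using add_le_add (h f hf) (h' f hf)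

theorem StochLE.smul {P Q : ℝ[X]} (h : StochLE P Q) {c : ℝ} (hc : 0 ≤ c) :
    StochLE (c • P) (c • Q) := fun f hf => by
  simpa only [map_smul, smul_eq_mul] using mul_le_mul_of_nonneg_left (h f hf) hc

theorem stochMul_X_pow (s : ℕ) : StochMul (X ^ s) := fun P Q h f hf => by
  rw [genExp_X_pow_mul, genExp_X_pow_mul]
  exact h _ fun a b hab => hf (Nat.add_le_add_left hab s)

theorem stochMul_one : StochMul 1 := by simpa using stochMul_X_pow 0

theorem StochMul.mul {R S : ℝ[X]} (hR : StochMul R) (hS : StochMul S) : StochMul (R * S) :=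
  fun P Q h => by simpa only [mul_assoc] using hR _ _ (hS _ _ h)

theorem StochMul.add {R S : ℝ[X]} (hR : StochMul R) (hS : StochMul S) : StochMul (R + S) :=
  fun P Q h => by simpa only [add_mul] using (hR _ _ h).add (hS _ _ h)

theorem StochMul.smul {R : ℝ[X]} (hR : StochMul R) {c : ℝ} (hc : 0 ≤ c) : StochMul (c • R) :=
  fun P Q h => by simpa only [smul_mul_assoc] using (hR _ _ h).smul hc

theorem stochMul_prod {ι : Type*} (s : Finset ι) (R : ι → ℝ[X]) (h : ∀ i, StochMul (R i)) :
    StochMul (∏ i ∈ s, R i) :=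
  Finset.prod_induction R StochMul (fun _ _ => StochMul.mul) stochMul_one fun i _ => h i

theorem StochLE.prod {ι : Type*} (s : Finset ι) (P Q : ι → ℝ[X]) (hP : ∀ i, StochMul (P i))
    (hQ : ∀ i, StochMul (Q i)) (h : ∀ i, StochLE (P i) (Q i)) :
    StochLE (∏ i ∈ s, P i) (∏ i ∈ s, Q i) := by
  classical
  induction s using Finset.induction_on with
  | empty => exact StochLE.refl _
  | insert a s ha ih =>
    rw [Finset.prod_insert ha, Finset.prod_insert ha]
    -- The other factors are replaced first, with `P a` as multiplier; then the factor at `a`, with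
    -- the `Q i` as multipliers.
    refine (hP a _ _ ih).trans ?_
    rw [mul_comm, mul_comm (Q a)]
    exact stochMul_prod s Q hQ _ _ (h a)

/-! ### Jobs left over on the machines, and the exchange argument. -/

/-- The generating function of the number of jobs that remain on a machine with `k` jobs after it
has processed them up to and including the first job of processing time `1`. -/
noncomputable def leftoverGen (q : ℝ) : ℕ → ℝ[X]
  | 0 => 1
  | k + 1 => q • X ^ k + (1 - q) • leftoverGen q k

variable {q : ℝ}

theorem stochMul_leftoverGen (h0 : 0 ≤ q) (h1 : q ≤ 1) (k : ℕ) : StochMul (leftoverGen q k) := by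
  induction k with
  | zero => exact stochMul_one
  | succ k ih =>
    exact ((stochMul_X_pow k).smul h0).add (ih.smul (sub_nonneg.2 h1))

/-- A job added at the end of a list increases what is left by at most one. The induction conditions
on the first job, and the case where it has length 1 gives equality. -/
theorem leftoverGen_succ_le (h1 : q ≤ 1) (k : ℕ) :
    StochLE (leftoverGen q (k + 1)) (X * leftoverGen q k) := by
  induction k with
  | zero =>
    intro f hf
    have h2 : leftoverGen q (0 + 1) = X ^ 0 := by
      simp only [leftoverGen, pow_zero]; module
    have h3 : X * leftoverGen q 0 = X ^ 1 := by simp [leftoverGen]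
    rw [h2, h3, genExp_X_pow, genExp_X_pow]
    exact hf zero_le_one
  | succ k ih =>
    have h2 : X * leftoverGen q (k + 1) =
        q • X ^ (k + 1) + (1 - q) • (X * leftoverGen q k) := by
      simp only [leftoverGen, mul_add, mul_smul_comm, pow_succ']
    rw [h2, leftoverGen]
    exact (StochLE.refl _).add (ih.smul (sub_nonneg.2 h1))

theorem leftoverGen_add_le (h1 : q ≤ 1) (k d : ℕ) :
    StochLE (leftoverGen q (k + d)) (X ^ d * leftoverGen q k) := by
  induction d with
  | zero => simpa using StochLE.refl _
  | succ d ih =>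
    refine (leftoverGen_succ_le h1 (k + d)).trans ?_
    have := stochMul_X_pow 1 _ _ ih
    rwa [pow_one, ← mul_assoc, ← pow_succ'] at this

/-- Put the extra job in front: if it has length 1, all `k` others are left, which is the maximum;
if it has length 0, nothing changes. -/
theorem leftoverGen_le_succ (h0 : 0 ≤ q) (h1 : q ≤ 1) (k : ℕ) :
    StochLE (leftoverGen q k) (leftoverGen q (k + 1)) := by
  have h2 : leftoverGen q k = q • leftoverGen q k + (1 - q) • leftoverGen q k := by module
  have h3 := leftoverGen_add_le h1 0 k
  rw [zero_add, leftoverGen, mul_one] at h3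
  rw [leftoverGen]
  nth_rw 1 [h2]
  exact (h3.smul h0).add (StochLE.refl _)

theorem leftoverGen_mono (h0 : 0 ≤ q) (h1 : q ≤ 1) {k l : ℕ} (h : k ≤ l) :
    StochLE (leftoverGen q k) (leftoverGen q l) := by
  induction l, h using Nat.le_induction with
  | base => exact StochLE.refl _
  | succ l _ ih => exact ih.trans (leftoverGen_le_succ h0 h1 l)

/-- Moving a job from a machine to one with fewer jobs reduces the number of jobs left. -/
theorem leftoverGen_exchange (h0 : 0 ≤ q) (h1 : q ≤ 1) {b c : ℕ} (h : b ≤ c) :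
    StochLE (leftoverGen q c * leftoverGen q (b + 1))
      (leftoverGen q (c + 1) * leftoverGen q b) := by
  obtain ⟨d, rfl⟩ := Nat.exists_eq_add_of_le h
  -- Let the moved job be first on its machine. If it has length 0, both sides agree. If it has
  -- length 1, the comparison is `leftoverGen q (b + d)` against `X ^ d * leftoverGen q b`, up to
  -- the factor `X ^ b`.
  have h2 : leftoverGen q (b + d) * leftoverGen q (b + 1) =
      q • (X ^ b * leftoverGen q (b + d)) + (1 - q) • (leftoverGen q (b + d) * leftoverGen q b) := by
    rw [leftoverGen, mul_add, mul_smul_comm, mul_smul_comm, mul_comm (X ^ b)]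
  have h3 : leftoverGen q (b + d + 1) * leftoverGen q b =
      q • (X ^ b * (X ^ d * leftoverGen q b)) +
        (1 - q) • (leftoverGen q (b + d) * leftoverGen q b) := by
    rw [leftoverGen, add_mul, smul_mul_assoc, smul_mul_assoc, ← mul_assoc, ← pow_add]
  rw [h2, h3]
  exact ((stochMul_X_pow b _ _ (leftoverGen_add_le h1 b d)).smul h0).add (StochLE.refl _)

/-- A balanced assignment stochastically minimizes the number of jobs left. -/
theorem stochLE_prod_leftoverGen_of_balanced (h0 : 0 ≤ q) (h1 : q ≤ 1) {ι : Type*} [Fintype ι]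
    (b : ι → ℕ) (hb : ∀ i j, b i ≤ b j + 1) (k : ι → ℕ) (hk : ∑ i, k i = ∑ i, b i) :
    StochLE (∏ i, leftoverGen q (b i)) (∏ i, leftoverGen q (k i)) := by
  classical
  -- Truncated subtraction: the measure is the total excess of `k` over `b`, which drops by one with
  -- each job moved.
  induction hD : ∑ i, (k i - b i) using Nat.strong_induction_on generalizing k with
  | _ D ih =>
  by_cases hkb : k = b
  · rw [hkb]; exact StochLE.refl _
  obtain ⟨i, hi⟩ : ∃ i, b i < k i := by
    by_contra! h
    exact hkb (funext fun i => (Finset.sum_eq_sum_iff_of_le fun i _ => h i).1 hk i (Finset.mem_univ i))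
  obtain ⟨j, hj⟩ : ∃ j, k j < b j := by
    by_contra! h
    exact hkb (funext fun i =>
      ((Finset.sum_eq_sum_iff_of_le fun i _ => h i).1 hk.symm i (Finset.mem_univ i)).symm)
  have hij : i ≠ j := by rintro rfl; omega
  -- This gives `k j < b j ≤ b i + 1 ≤ k i`, hence `k j ≤ c`, as the exchange of a job from `i` to
  -- `j` requires.
  have hbij := hb j i
  obtain ⟨c, hc⟩ : ∃ c, k i = c + 1 := ⟨k i - 1, by omega⟩
  have hsplit : ∀ {M : Type} [CommMonoid M] (g : ι → M),
      ∏ l, g l = g i * g j * ∏ l ∈ (Finset.univ.erase i).erase j, g l := by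
    intro M _ g
    rw [mul_assoc, Finset.mul_prod_erase _ _ (Finset.mem_erase.2 ⟨hij.symm, Finset.mem_univ j⟩),
      Finset.mul_prod_erase _ _ (Finset.mem_univ i)]
  have hsplit' : ∀ g : ι → ℕ,
      ∑ l, g l = g i + g j + ∑ l ∈ (Finset.univ.erase i).erase j, g l := by
    intro g
    rw [add_assoc, Finset.add_sum_erase _ _ (Finset.mem_erase.2 ⟨hij.symm, Finset.mem_univ j⟩),
      Finset.add_sum_erase _ _ (Finset.mem_univ i)]
  let k' : ι → ℕ := Function.update (Function.update k i c) j (k j + 1)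
  have hk'i : k' i = c := by simp [k', hij]
  have hk'j : k' j = k j + 1 := by simp [k']
  have hk' : ∀ l ∈ (Finset.univ.erase i).erase j, k' l = k l := fun l hl => by
    simp only [Finset.mem_erase] at hl
    simp [k', hl.1, hl.2.1]
  refine (ih (∑ l, (k' l - b l)) ?_ k' ?_ rfl).trans ?_
  · rw [← hD, hsplit' fun l => k' l - b l, hsplit' fun l => k l - b l,
      Finset.sum_congr rfl fun l hl => by rw [hk' l hl]]
    omega
  · have h2 : ∑ l ∈ (Finset.univ.erase i).erase j, k' l =
        ∑ l ∈ (Finset.univ.erase i).erase j, k l := Finset.sum_congr rfl hk'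
    rw [← hk, hsplit' k', hsplit' k, h2]
    omega
  · rw [hsplit fun l => leftoverGen q (k' l), hsplit fun l => leftoverGen q (k l),
      Finset.prod_congr rfl fun l hl => by rw [hk' l hl], hk'i, hk'j, hc,
      mul_comm, mul_comm (_ * _) (Finset.prod _ _)]
    exact stochMul_prod _ _ (fun l => stochMul_leftoverGen h0 h1 _) _ _
      (leftoverGen_exchange h0 h1 (by omega))

/-! ### The value function of balanced assignments. -/

/-- Hermite's identity for naturals: `fun i => (r + i) / m` is a balanced distribution of `r` jobs
to `m` machines. -/
theorem sum_add_div_eq (m r : ℕ) (hm : 1 ≤ m) : ∑ i : Fin m, (r + i) / m = r := by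
  rw [Fin.sum_univ_eq_sum_range fun i => (r + i) / m]
  induction r with
  | zero =>
    refine Finset.sum_eq_zero fun i hi => ?_
    rw [zero_add, Nat.div_eq_of_lt (Finset.mem_range.1 hi)]
  | succ r ih =>
    -- Passing from `r` to `r + 1` shifts the window of summation: `r / m` leaves and `(r + m) / m =
    -- r / m + 1` enters.
    have h1 := Finset.sum_range_succ' (fun i => (r + i) / m) m
    rw [Finset.sum_range_succ, ih, Nat.add_div_right r hm] at h1
    have h2 : ∑ i ∈ Finset.range m, (r + 1 + i) / m = ∑ i ∈ Finset.range m, (r + (i + 1)) / m :=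
      Finset.sum_congr rfl fun i _ => by rw [add_assoc, add_comm 1]
    rw [h2]
    simp only [add_zero] at h1
    omega

/-- The expected cost over `s` units of time if `r` jobs remain and all assignments are
balanced. -/
noncomputable def balancedValue (q : ℝ) (m : ℕ) : ℕ → ℕ → ℝ
  | 0, _ => 0
  | s + 1, r => 1 - (1 - q) ^ r +
      genExp (balancedValue q m s) (∏ i : Fin m, leftoverGen q ((r + i) / m))

theorem balancedValue_mono (h0 : 0 ≤ q) (h1 : q ≤ 1) (m s : ℕ) :
    Monotone (balancedValue q m s) := by
  induction s with
  | zero => exact fun _ _ _ => le_rfl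
  | succ s ih =>
    intro r r' hr
    refine add_le_add (sub_le_sub_left ?_ _) ?_
    · exact pow_le_pow_of_le_one (sub_nonneg.2 h1) (by linarith) hr
    · refine StochLE.prod _ _ _ (fun _ => stochMul_leftoverGen h0 h1 _)
        (fun _ => stochMul_leftoverGen h0 h1 _) (fun i => leftoverGen_mono h0 h1 ?_) _ ih
      exact Nat.div_le_div_right (Nat.add_le_add_right hr _)

theorem le_genExp_prod_leftoverGen (h0 : 0 ≤ q) (h1 : q ≤ 1) {m r s : ℕ} (hm : 1 ≤ m)
    (k : Fin m → ℕ) (hk : ∑ i, k i = r) :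
    balancedValue q m (s + 1) r ≤
      1 - (1 - q) ^ r + genExp (balancedValue q m s) (∏ i, leftoverGen q (k i)) := by
  refine add_le_add le_rfl (stochLE_prod_leftoverGen_of_balanced h0 h1 _ (fun i j => ?_) k
    (hk.trans (sum_add_div_eq m r hm).symm) _ (balancedValue_mono h0 h1 m s))
  rw [← Nat.add_div_right _ hm]
  exact Nat.div_le_div_right (by omega)

theorem genExp_prod_leftoverGen_eq (h0 : 0 ≤ q) (h1 : q ≤ 1) {m r s : ℕ} (hm : 1 ≤ m)
    (k : Fin m → ℕ) (hk : ∑ i, k i = r) (hb : ∀ i j, k i ≤ k j + 1) :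
    1 - (1 - q) ^ r + genExp (balancedValue q m s) (∏ i, leftoverGen q (k i)) =
      balancedValue q m (s + 1) r := by
  refine le_antisymm (add_le_add le_rfl ?_) (le_genExp_prod_leftoverGen h0 h1 hm k hk)
  exact stochLE_prod_leftoverGen_of_balanced h0 h1 k hb _
    ((sum_add_div_eq m r hm).trans hk.symm) _ (balancedValue_mono h0 h1 m s)

end Leftover

/-! ### Lists of jobs and the law of what is left of them. -/

/-- The jobs of a list behind the first job of processing time `1`. -/
def leftoverJobs {n : ℕ} (p : Fin n → Fin 2) : List (Fin n) → List (Fin n)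
  | [] => []
  | j :: l => if p j = 1 then l else leftoverJobs p l

section lists

variable {n : ℕ}

theorem startedJobs_append_leftoverJobs (p : Fin n → Fin 2) (l : List (Fin n)) :
    startedJobs p l ++ leftoverJobs p l = l := by
  induction l with
  | nil => rfl
  | cons j l ih => by_cases h : p j = 1 <;> simp [startedJobs, leftoverJobs, h, ih]

theorem mem_of_mem_startedJobs {p : Fin n → Fin 2} {l : List (Fin n)} {j : Fin n}
    (h : j ∈ startedJobs p l) : j ∈ l := by
  rw [← startedJobs_append_leftoverJobs p l]
  exact List.mem_append_left _ h

theorem startedJobs_congr {p p' : Fin n → Fin 2} {l : List (Fin n)}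
    (h : ∀ j ∈ startedJobs p l, p' j = p j) : startedJobs p' l = startedJobs p l := by
  induction l with
  | nil => rfl
  | cons j l ih =>
    by_cases hj : p j = 1
    · have := h j (by simp [startedJobs, hj])
      simp [startedJobs, hj, this]
    · have h2 := h j (by simp [startedJobs, hj])
      simp only [startedJobs, hj, h2, if_false, List.mem_cons, forall_eq_or_imp] at h ⊢
      rw [ih h.2]

theorem startedJobs_eq_self {p : Fin n → Fin 2} {l : List (Fin n)}
    (h : ∀ j ∈ l, p j ≠ 1) : startedJobs p l = l := by
  induction l with
  | nil => rfl
  | cons j l ih =>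
    simp only [List.mem_cons, forall_eq_or_imp] at h
    simp [startedJobs, h.1, ih h.2]

theorem leftoverJobs_congr {p p' : Fin n → Fin 2} {l : List (Fin n)}
    (h : ∀ j ∈ l, p j = p' j) : leftoverJobs p l = leftoverJobs p' l := by
  induction l with
  | nil => rfl
  | cons j l ih =>
    simp only [List.mem_cons, forall_eq_or_imp] at h
    simp only [leftoverJobs, h.1, ih h.2]

theorem sum_count_eq_length (l : List (Fin n)) : ∑ j, l.count j = l.length := by
  simpa using Multiset.sum_count_eq_card (s := Finset.univ) (m := (l : Multiset (Fin n)))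
    fun _ _ => Finset.mem_univ _

/-- A list can be distributed to lists of prescribed lengths. -/
theorem exists_lists_of_length {m : ℕ} (l : List (Fin n)) (k : Fin m → ℕ)
    (hk : ∑ i, k i = l.length) :
    ∃ ls : Fin m → List (Fin n), (∀ j, ∑ i, (ls i).count j = l.count j) ∧
      ∀ i, (ls i).length = k i := by
  induction l generalizing k with
  | nil =>
    refine ⟨fun _ => [], by simp, fun i => ?_⟩
    simp only [List.length_nil, Finset.sum_eq_zero_iff] at hk
    simp [hk i]
  | cons a l ih =>
    obtain ⟨i, -, hi⟩ := Finset.exists_ne_zero_of_sum_ne_zero (s := Finset.univ) (f := k)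
      (by rw [hk]; simp)
    obtain ⟨ls, h1, h2⟩ := ih (Function.update k i (k i - 1)) (by
      rw [Finset.sum_update_of_mem (Finset.mem_univ i)]
      rw [← Finset.add_sum_erase _ _ (Finset.mem_univ i), List.length_cons] at hk
      rw [Finset.sdiff_singleton_eq_erase]
      omega)
    refine ⟨Function.update ls i (a :: ls i), fun j => ?_, fun i' => ?_⟩
    · have h3 : ∀ i', (Function.update ls i (a :: ls i) i').count j =
          (ls i').count j + if i' = i then (if a = j then 1 else 0) else 0 := by
        intro i'
        by_cases h : i' = i
        · subst h; simp [List.count_cons]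
        · simp [h]
      simp [h3, Finset.sum_add_distrib, h1, List.count_cons]
    · have h4 := h2 i'
      by_cases h : i' = i
      · subst h
        simp only [Function.update_self, List.length_cons] at h4 ⊢
        omega
      · simpa [h] using h4

open Polynomial in
/-- The jobs left over from a list are independent of the jobs not in the list. -/
theorem bernoulliExp_leftoverJobs_mul {q : ℝ} (l : List (Fin n)) (hl : l.Nodup)
    (F : (Fin n → Fin 2) → ℝ[X]) (hF : ∀ p p', (∀ j ∉ l, p j = p' j) → F p = F p') :
    bernoulliExp q (fun p => X ^ (leftoverJobs p l).length * F p) =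
      leftoverGen q l.length * bernoulliExp q F := by
  induction l with
  | nil => simp [leftoverJobs, leftoverGen]
  | cons a l ih =>
    rw [List.nodup_cons] at hl
    have hF' : ∀ p p', (∀ j ≠ a, p j = p' j) → F p = F p' := fun p p' h =>
      hF p p' fun j hj => h j fun hja => hj (by simp [hja])
    have h1 : (fun p => X ^ (leftoverJobs p (a :: l)).length * F p) = fun p =>
        if p a = 1 then (fun p => X ^ l.length * F p) p
          else (fun p => X ^ (leftoverJobs p l).length * F p) p := by
      ext1 p
      by_cases h : p a = 1 <;> simp [leftoverJobs, h]
    have h2 : bernoulliExp q (fun p => X ^ l.length * F p) =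
        X ^ l.length * bernoulliExp q F := by
      simp only [bernoulliExp, Finset.mul_sum, mul_smul_comm]
    rw [h1, bernoulliExp_ite, h2, ih hl.2]
    · simp only [List.length_cons, leftoverGen, add_mul, smul_mul_assoc]
    · exact fun p p' h => hF p p' fun j hj => h j fun hja => hj (by simp [hja])
    · exact fun p p' h => by rw [hF' p p' h]
    · exact fun p p' h => by
        rw [hF' p p' h, leftoverJobs_congr fun j hj => h j (by rintro rfl; exact hl.1 hj)]

-- Machines are peeled off one at a time: the lists are disjoint, so the other factors do not
-- involve the jobs of the current one.
open Polynomial in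
theorem bernoulliExp_prod_leftoverJobs {q : ℝ} {ι : Type*} (s : Finset ι)
    (ls : ι → List (Fin n)) (hn : ∀ i, (ls i).Nodup)
    (hd : ∀ i i', i ≠ i' → ∀ j ∈ ls i, j ∉ ls i') :
    bernoulliExp q (fun p => ∏ i ∈ s, (X : ℝ[X]) ^ (leftoverJobs p (ls i)).length) =
      ∏ i ∈ s, leftoverGen q (ls i).length := by
  classical
  induction s using Finset.induction_on with
  | empty => simp [bernoulliExp_const]
  | insert a s ha ih =>
    simp only [Finset.prod_insert ha]
    rw [bernoulliExp_leftoverJobs_mul _ (hn a), ih]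
    intro p p' h
    refine Finset.prod_congr rfl fun i hi => ?_
    rw [leftoverJobs_congr fun j hj => h j (hd i a (by rintro rfl; exact ha hi) j hj)]

end lists

/-! ### Histories, remaining jobs and the makespan of a policy. -/

namespace ActivePolicy

variable {m n : ℕ} (π : ActivePolicy m n) (p : Fin n → Fin 2)

theorem eq_none_of_mem_assign {t : ℕ} {h : History n} {i : Fin m} {j : Fin n}
    (hj : j ∈ π.assign t h i) : h j = none := by
  by_contra hne
  have h2 := π.valid t h j
  rw [if_neg hne, Finset.sum_eq_zero_iff] at h2
  exact List.count_eq_zero.1 (h2 i (Finset.mem_univ i)) hj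

theorem exists_mem_assign {t : ℕ} {h : History n} {j : Fin n} (hj : h j = none) :
    ∃ i, j ∈ π.assign t h i := by
  have h1 := π.valid t h j
  rw [if_pos hj] at h1
  obtain ⟨i, -, hi⟩ := Finset.exists_ne_zero_of_sum_ne_zero (by rw [h1]; exact one_ne_zero)
  exact ⟨i, by simpa [List.count_eq_zero] using hi⟩

theorem count_assign_le_one (t : ℕ) (h : History n) (i : Fin m) (j : Fin n) :
    (π.assign t h i).count j ≤ 1 := by
  refine (Finset.single_le_sum (f := fun i => (π.assign t h i).count j)
    (fun _ _ => Nat.zero_le _) (Finset.mem_univ i)).trans ?_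
  rw [π.valid]
  split_ifs <;> simp

theorem nodup_assign (t : ℕ) (h : History n) (i : Fin m) : (π.assign t h i).Nodup :=
  List.nodup_iff_count_le_one.2 (π.count_assign_le_one t h i)

theorem notMem_assign_of_ne {t : ℕ} {h : History n} {i i' : Fin m} (hi : i ≠ i') {j : Fin n}
    (hj : j ∈ π.assign t h i) : j ∉ π.assign t h i' := by
  intro hj'
  have h1 := π.valid t h j
  rw [if_pos (π.eq_none_of_mem_assign hj)] at h1
  have h2 := Finset.sum_le_sum_of_subset (f := fun i => (π.assign t h i).count j)
    (Finset.subset_univ {i, i'})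
  rw [h1, Finset.sum_pair hi] at h2
  have h3 := List.count_pos_iff.2 hj
  have h4 := List.count_pos_iff.2 hj'
  omega

theorem sum_length_assign (t : ℕ) (h : History n) :
    ∑ i, (π.assign t h i).length = h.numRemaining := by
  simp_rw [← sum_count_eq_length]
  rw [Finset.sum_comm]
  simp [π.valid, History.numRemaining]

/-- The history at time `t + 1`, given the history at time `t`. -/
def nextHistory (t : ℕ) (h : History n) : History n := fun j =>
  if h j = none ∧ ∃ i, j ∈ startedJobs p (π.assign t h i) then some (t, p j) else h j

theorem numRemaining_nextHistory (t : ℕ) (h : History n) :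
    (π.nextHistory p t h).numRemaining = ∑ i, (leftoverJobs p (π.assign t h i)).length := by
  simp_rw [← sum_count_eq_length]
  rw [Finset.sum_comm, History.numRemaining, Finset.card_filter]
  refine Finset.sum_congr rfl fun j _ => ?_
  have h1 := π.valid t h j
  have h2 : ∑ i, (π.assign t h i).count j = ∑ i, (startedJobs p (π.assign t h i)).count j +
      ∑ i, (leftoverJobs p (π.assign t h i)).count j := by
    rw [← Finset.sum_add_distrib]
    refine Finset.sum_congr rfl fun i _ => ?_
    rw [← List.count_append, startedJobs_append_leftoverJobs]
  have h3 : (∃ i, j ∈ startedJobs p (π.assign t h i)) ↔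
      ∑ i, (startedJobs p (π.assign t h i)).count j ≠ 0 := by
    simp [Finset.sum_eq_zero_iff, List.count_eq_zero]
  simp only [nextHistory, h3]
  by_cases hj : h j = none
  · rw [h2, if_pos hj] at h1
    by_cases h4 : ∑ i, (startedJobs p (π.assign t h i)).count j = 0
    · simp only [hj, h4, ne_eq, not_true_eq_false, and_false, if_false, if_true]
      omega
    · simp only [hj, h4, ne_eq, not_false_eq_true, and_self, if_true]
      simp only [reduceCtorEq, if_false]
      omega
  · rw [h2, if_neg hj] at h1
    simp only [hj, false_and, if_false]
    omega

/-- The history only depends on the processing times of the jobs started. -/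
theorem history_congr {p p' : Fin n → Fin 2} {t : ℕ}
    (h : ∀ j, π.history p t j ≠ none → p' j = p j) : π.history p' t = π.history p t := by
  induction t with
  | zero => rfl
  | succ t ih =>
    have h1 := ih fun j hj => h j fun h0 => hj (π.history_mono p t j h0)
    have h2 : ∀ i, startedJobs p' (π.assign t (π.history p t) i) =
        startedJobs p (π.assign t (π.history p t) i) := fun i => startedJobs_congr fun j hj => by
      refine h j ?_
      have := π.eq_none_of_mem_assign (mem_of_mem_startedJobs hj)
      have h3 : ∃ i, j ∈ startedJobs p (π.assign t (π.history p t) i) := ⟨i, hj⟩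
      simp [history, this, h3]
    ext1 j
    simp only [history, h1, h2]
    split_ifs with h3
    · rw [h j]
      simp [history, h3]
    · rfl

/-- Some remaining job has processing time `1`. -/
def Busy (h : History n) : Prop := ∃ j ∈ Finset.univ.filter fun j => h j = none, p j = 1

theorem history_eq_none_iff (t : ℕ) (j : Fin n) :
    π.history p t j = none ↔ t ≤ π.startTime p j := by
  have hmono : ∀ s u, s ≤ u → π.history p u j = none → π.history p s j = none := by
    intro s u hsu
    induction u, hsu using Nat.le_induction with
    | base => exact id
    | succ u _ ih => exact fun h => ih (π.history_mono p u j h)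
  rw [startTime, Nat.le_find_iff]
  constructor
  · intro h s hs h'
    exact h' (hmono _ _ hs h)
  · intro h
    cases t with
    | zero => rfl
    | succ t => exact not_not.1 (h t (Nat.lt_succ_self t))

/-- Jobs started before `t` are completed by `t`, and if all remaining jobs have length 0, they all
start and finish at `t`. -/
theorem busy_iff_lt_makespan (t : ℕ) :
    Busy p (π.history p t) ↔ t < π.makespan p := by
  constructor
  · rintro ⟨j, hj, hpj⟩
    have h1 := (π.history_eq_none_iff p t j).1 (by simpa using hj)
    have h2 : π.startTime p j + (p j : ℕ) ≤ π.makespan p :=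
      Finset.le_sup (f := fun j => π.startTime p j + (p j : ℕ)) (Finset.mem_univ j)
    rw [hpj] at h2
    simp at h2
    omega
  · contrapose!
    intro h
    refine Finset.sup_le fun j _ => ?_
    have h0 : ∀ j, π.history p t j = none → p j ≠ 1 := fun j hj hp =>
      h ⟨j, by simpa using hj, hp⟩
    by_cases hj : π.history p t j = none
    · have h1 : (p j : ℕ) = 0 := by
        have := h0 j hj
        omega
      rw [h1, add_zero]
      by_contra! h2
      have h3 := (π.history_eq_none_iff p (t + 1) j).2 h2
      obtain ⟨i, hi⟩ := π.exists_mem_assign (t := t) hj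
      have h4 : ∃ i, j ∈ startedJobs p (π.assign t (π.history p t) i) :=
        ⟨i, by
          rw [startedJobs_eq_self fun j' hj' => h0 j' (π.eq_none_of_mem_assign hj')]
          exact hi⟩
      simp [history, hj, h4] at h3
    · have h1 := mt (π.history_eq_none_iff p t j).2 hj
      omega

theorem makespan_le (p : Fin n → Fin 2) : π.makespan p ≤ n := by
  rw [← not_lt, ← busy_iff_lt_makespan]
  rintro ⟨j, hj, -⟩
  have h1 := π.numRemaining_le p n
  rw [Nat.sub_self, Nat.le_zero, History.numRemaining, Finset.card_eq_zero] at h1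
  simp [h1] at hj

open scoped Classical in
theorem makespan_eq_sum (p : Fin n → Fin 2) :
    (π.makespan p : ℝ) =
      ∑ t ∈ Finset.range n, if Busy p (π.history p t) then (1 : ℝ) else 0 := by
  simp only [busy_iff_lt_makespan]
  rw [Finset.sum_boole]
  congr 1
  have : (Finset.range n).filter (· < π.makespan p) = Finset.range (π.makespan p) := by
    ext t
    have := π.makespan_le p
    simp only [Finset.mem_filter, Finset.mem_range]
    omega
  rw [this, Finset.card_range]

variable {q : ℝ}

open Polynomial in
/-- The expectation of a function of the number of jobs remaining at the next integer time. -/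
theorem bernoulliExp_numRemaining_nextHistory (f : ℕ → ℝ) (t : ℕ) (h : History n) :
    bernoulliExp q (fun p => f (π.nextHistory p t h).numRemaining) =
      genExp f (∏ i, leftoverGen q (π.assign t h i).length) := by
  rw [← bernoulliExp_prod_leftoverJobs _ _ (π.nodup_assign t h)
    fun i i' hi j hj => π.notMem_assign_of_ne hi hj, map_bernoulliExp]
  simp only [numRemaining_nextHistory, Finset.prod_pow_eq_pow_sum, genExp_X_pow]

open scoped Classical in
/-- The expected cost from time `t` on, if it is `f` of the number of jobs remaining at time
`t + 1` plus `1` if a machine is busy between `t` and `t + 1`. -/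
theorem bernoulliExp_step (f : ℕ → ℝ) (t : ℕ) :
    bernoulliExp q (fun p => (if Busy p (π.history p t) then (1 : ℝ) else 0) +
      f (π.history p (t + 1)).numRemaining) =
    bernoulliExp q fun p => 1 - (1 - q) ^ (π.history p t).numRemaining +
      genExp f (∏ i, leftoverGen q (π.assign t (π.history p t) i).length) := by
  -- Condition on the history at time `t`: it is determined by the jobs already started, while the
  -- cost from `t` on involves only the remaining ones, which are resampled.
  have h1 := bernoulliExp_resample (q := q) (fun p => π.history p t)
    (fun h => Finset.univ.filter fun j => h j ≠ none)
    (fun p p' h => π.history_congr fun j hj => h j (by simpa using hj))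
    (fun h p => (if Busy p h then (1 : ℝ) else 0) + f (π.nextHistory p t h).numRemaining) ?_
  · refine Eq.trans h1 (congrArg _ (funext fun p => ?_))
    rw [bernoulliExp_add, bernoulliExp_numRemaining_nextHistory]
    congr 1
    convert! bernoulliExp_exists (q := q) (Finset.univ.filter fun j => π.history p t j = none)
  · intro p p' p'' h
    simp only [Finset.mem_filter_univ, not_not] at h
    have h2 : Busy p' (π.history p t) ↔ Busy p'' (π.history p t) := by
      refine exists_congr fun j => and_congr_right fun hj => ?_
      rw [h j (by simpa using hj)]
    simp only [h2, numRemaining_nextHistory,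
      leftoverJobs_congr fun j hj => h j (π.eq_none_of_mem_assign hj)]

/-! ### Comparison of an arbitrary policy with balanced ones. -/

open scoped Classical in
/-- The expected cost of a policy that is replaced by an optimal one from time `u` on. -/
noncomputable def hybridCost (q : ℝ) (u : ℕ) : ℝ :=
  bernoulliExp q fun p => (∑ t ∈ Finset.range u, if Busy p (π.history p t) then (1 : ℝ) else 0) +
    balancedValue q m (n - u) (π.history p u).numRemaining

theorem hybridCost_zero : π.hybridCost q 0 = balancedValue q m n n := by
  simp [hybridCost, history, History.numRemaining, bernoulliExp_const]

/-- The horizon `n` suffices because the makespan is at most `n`; no balanced steps remain at `u =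
n`. -/
theorem hybridCost_last : π.hybridCost q n = bernoulliExp q fun p => (π.makespan p : ℝ) := by
  simp [hybridCost, makespan_eq_sum, balancedValue]

-- Conditioning at time `u` puts this in the same form as `hybridCost q u`, so that the two can be
-- compared history by history.
open scoped Classical in
theorem hybridCost_succ (u : ℕ) :
    π.hybridCost q (u + 1) = bernoulliExp q fun p =>
      (∑ t ∈ Finset.range u, if Busy p (π.history p t) then (1 : ℝ) else 0) +
      (1 - (1 - q) ^ (π.history p u).numRemaining + genExp (balancedValue q m (n - (u + 1)))
        (∏ i, leftoverGen q (π.assign u (π.history p u) i).length)) := by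
  rw [bernoulliExp_add, ← bernoulliExp_step, ← bernoulliExp_add]
  simp only [hybridCost, Finset.sum_range_succ, add_assoc]

theorem hybridCost_le_succ (h0 : 0 ≤ q) (h1 : q ≤ 1) (hm : 1 ≤ m) (u : ℕ) (hu : u < n) :
    π.hybridCost q u ≤ π.hybridCost q (u + 1) := by
  rw [hybridCost_succ]
  refine bernoulliExp_mono h0 h1 fun p => add_le_add le_rfl ?_
  obtain ⟨s, hs⟩ : ∃ s, n - u = s + 1 := ⟨n - u - 1, by omega⟩
  rw [hs, ← Nat.sub_sub, hs, Nat.add_sub_cancel]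
  exact le_genExp_prod_leftoverGen h0 h1 hm _ (π.sum_length_assign _ _)

theorem IsBalanced.hybridCost_eq_succ {π : ActivePolicy m n} (hπ : π.IsBalanced) (h0 : 0 ≤ q)
    (h1 : q ≤ 1) (hm : 1 ≤ m) (u : ℕ) (hu : u < n) :
    π.hybridCost q (u + 1) = π.hybridCost q u := by
  rw [hybridCost_succ, hybridCost]
  refine congrArg _ (funext fun p => congrArg₂ _ rfl ?_)
  obtain ⟨s, hs⟩ : ∃ s, n - u = s + 1 := ⟨n - u - 1, by omega⟩
  rw [hs, ← Nat.sub_sub, hs, Nat.add_sub_cancel]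
  refine genExp_prod_leftoverGen_eq h0 h1 hm _ (π.sum_length_assign _ _) fun i j => ?_
  have hi := hπ p u i
  have hj := hπ p u j
  rw [Nat.ceilDiv_eq_add_pred_div] at hi hj
  have h2 : ((π.history p u).numRemaining + m - 1) / m ≤
      (π.history p u).numRemaining / m + 1 := by
    rw [← Nat.add_div_right _ hm]
    exact Nat.div_le_div_right (by omega)
  have h3 : (π.history p u).numRemaining / m ≤
      ((π.history p u).numRemaining + m - 1) / m := Nat.div_le_div_right (by omega)
  omega

theorem balancedValue_le (h0 : 0 ≤ q) (h1 : q ≤ 1) (hm : 1 ≤ m) :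
    balancedValue q m n n ≤ bernoulliExp q fun p => (π.makespan p : ℝ) := by
  rw [← hybridCost_zero π, ← hybridCost_last]
  have : ∀ u ≤ n, π.hybridCost q 0 ≤ π.hybridCost q u := by
    intro u
    induction u with
    | zero => exact fun _ => le_rfl
    | succ u ih => exact fun hu => (ih (by omega)).trans (π.hybridCost_le_succ h0 h1 hm u hu)
  exact this n le_rfl

theorem IsBalanced.balancedValue_eq {π : ActivePolicy m n} (hπ : π.IsBalanced) (h0 : 0 ≤ q)
    (h1 : q ≤ 1) (hm : 1 ≤ m) :
    bernoulliExp q (fun p => (π.makespan p : ℝ)) = balancedValue q m n n := by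
  rw [← hybridCost_zero π, ← hybridCost_last]
  have : ∀ u ≤ n, π.hybridCost q u = π.hybridCost q 0 := by
    intro u
    induction u with
    | zero => exact fun _ => rfl
    | succ u ih => exact fun hu => (hπ.hybridCost_eq_succ h0 h1 hm u hu).trans (ih (by omega))
  exact this n le_rfl

theorem exists_isBalanced (m n : ℕ) (hm : 1 ≤ m) : ∃ π : ActivePolicy m n, π.IsBalanced := by
  have hex : ∀ h : History n, ∃ ls : Fin m → List (Fin n),
      (∀ j, ∑ i, (ls i).count j = if h j = none then 1 else 0) ∧
      ∀ i, (ls i).length = (h.numRemaining + i) / m := by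
    intro h
    obtain ⟨ls, h1, h2⟩ := exists_lists_of_length
      (Finset.univ.filter fun j => h j = none).toList
      (fun i : Fin m => (h.numRemaining + i) / m)
      (by rw [sum_add_div_eq m _ hm, Finset.length_toList]; rfl)
    refine ⟨ls, fun j => ?_, h2⟩
    rw [h1, List.Nodup.count (Finset.nodup_toList _)]
    simp
  choose ls h1 h2 using hex
  -- The lengths `(r + i) / m` lie between the floor and the ceiling of `r / m`, which differ by at
  -- most one.
  refine ⟨⟨fun _ h => ls h, fun _ h => h1 h⟩, fun p t i => ?_⟩
  simp only [h2, Nat.ceilDiv_eq_add_pred_div]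
  generalize History.numRemaining _ = r
  have hi := i.2
  have h3 : (r + i) / m ≤ (r + m - 1) / m := Nat.div_le_div_right (by omega)
  have h4 : r / m ≤ (r + i) / m := Nat.div_le_div_right (by omega)
  have h5 : (r + m - 1) / m ≤ r / m + 1 := by
    rw [← Nat.add_div_right _ hm]
    exact Nat.div_le_div_right (by omega)
  omega

end ActivePolicy

theorem mainTheorem3 {Ω : Type*} [MeasurableSpace Ω] (μ : Measure Ω) [IsProbabilityMeasure μ]
    (m N : ℕ) (hm : 1 ≤ m) (hN : 1 ≤ N) (P : Fin (N * m) → Ω → Fin 2) (hP : IsInstance μ m N P) :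
    (∃ π : ActivePolicy m (N * m), π.IsBalanced) ∧
    ∀ π : ActivePolicy m (N * m), π.IsBalanced →
      ∀ σ : ActivePolicy m (N * m), expectedMakespan μ P π ≤ expectedMakespan μ P σ := by
  refine ⟨ActivePolicy.exists_isBalanced m _ hm, fun π hπ σ => ?_⟩
  have h0 : (0 : ℝ) ≤ (N : ℝ)⁻¹ := inv_nonneg.2 N.cast_nonneg
  have h1 : (N : ℝ)⁻¹ ≤ 1 := Nat.cast_inv_le_one N
  rw [expectedMakespan, expectedMakespan,
    hP.integral_eq fun p => (π.makespan p : ℝ), hP.integral_eq fun p => (σ.makespan p : ℝ),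
    hπ.balancedValue_eq h0 h1 hm]
  exact σ.balancedValue_le h0 h1 hm
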